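/- Let $A\in\mathbb{R}^{n\times n}$ be symmetric with entries $a_{ij}$ and columns $a_1,\dots,a_n$, let $N\ge 1$, and let $z_1,\dots,z_N$ be independent random vectors in $\mathbb{R}^n$ with $z_k\sim\mathcal{N}(0,I)$. Consider the normalized Gaussian Monte Carlo estimator $$\widehat A=\Big(\sum_{k=1}^N A z_k z_k^\top\Big)\oslash\Big(\sum_{k=1}^N z_k z_k^\top\Big),$$ where $\oslash$ denotes elementwise division, and write $\widehat a_{ii}$ for its diagonal entries. Let $T_N$ have the Student $t$-distribution with $N$ degrees of freedom, that is, the distribution of $Z/\sqrt{U/N}$, where $Z\sim\mathcal N(0,1)$ and $U$ is an independent chi-square random variable with $N$ degrees of freedom. Then for every $1\le i\le n$, the denominator $\sum_{k}(z_k)_i^2$ of $\widehat a_{ii}$ is almost surely nonzero, and $$\widehat a_{ii}-a_{ii}\ \sim\ \sqrt{\frac{\|a_i\|_2^2-a_{ii}^2}{N}}\;T_N .$$ Moreover, for every $1\le i\le n$ and every $t>0$, $$\mathbb P\big[\,|\widehat a_{ii}-a_{ii}|>t\,\big]\ \le\ \sqrt{\frac{2\,(\|a_i\|_2^2-a_{ii}^2)}{\pi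 N}}\;\frac1t\;\Big(1+\frac{t^2}{\|a_i\|_2^2-a_{ii}^2}\Big)^{-\frac{N-1}{2}},$$ where the right-hand side is read as $0$ if $\|a_i\|_2^2=a_{ii}^2$. -/

import Mathlib

open MeasureTheory ProbabilityTheory

/-- Elementwise division `B ⊘ C` of two real matrices of the same size. -/
noncomputable def elementwiseDiv {m n : Type*} (B C : Matrix m n ℝ) : Matrix m n ℝ :=
  Matrix.of fun i j => B i j / C i j

/-- The normalized Monte Carlo estimator
`(∑ k, A z_k z_kᵀ) ⊘ (∑ k, z_k z_kᵀ)` built from the sample vectors `z_1, …, z_N`. -/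
noncomputable def normalizedEstimator {n N : ℕ} (A : Matrix (Fin n) (Fin n) ℝ)
    (z : Fin N → EuclideanSpace ℝ (Fin n)) : Matrix (Fin n) (Fin n) ℝ :=
  elementwiseDiv (∑ k, A * Matrix.vecMulVec (z k) (z k)) (∑ k, Matrix.vecMulVec (z k) (z k))

/-- The chi-square distribution with `N` degrees of freedom: the law of the sum of the squares
of `N` independent standard normal random variables. -/
noncomputable def chiSquare (N : ℕ) : Measure ℝ :=
  (Measure.pi fun _ : Fin N => gaussianReal 0 1).map fun x => ∑ k, x k ^ 2

/-- The Student `t`-distribution with `N` degrees of freedom: the law of `Z / √(U / N)`, where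
`Z` is standard normal and `U` is chi-square with `N` degrees of freedom, independent of `Z`. -/
noncomputable def studentT (N : ℕ) : Measure ℝ :=
  ((gaussianReal 0 1).prod (chiSquare N)).map fun p => p.1 / √(p.2 / (N : ℝ))

/-- The squared Euclidean norm `‖a_i‖₂²` of the `i`-th column of `A`. -/
noncomputable def colNormSq {n : ℕ} (A : Matrix (Fin n) (Fin n) ℝ) (i : Fin n) : ℝ :=
  ‖(WithLp.toLp 2 (A.col i) : EuclideanSpace ℝ (Fin n))‖ ^ 2

open scoped ENNReal NNReal RealInnerProductSpace

/-! By symmetry of `A`, the `i`-th diagonal error is `∑ x_k w_k / ∑ x_k²` with `x_k = (z_k)_i` and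
`w_k = ⟪a_i - a_ii e_i, z_k⟫`. Since `a_i - a_ii e_i ⟂ e_i`, the vectors `x` and `w` are
independent. Given `x`, with `q = ∑ x_k²`, the ratio is centred Gaussian of variance `s²/q`, where
`s² = ‖a_i‖² - a_ii²`. This is also the law of `(s/√N) T_N` given its chi-square variable `q`.

For the tail, `P(|G/√q| > a)` is an integral over `y > a` of a multiple of `√q exp(-y²q/2)`. After
Fubini, the expectation over `q` is found by Gaussian tilting, which yields `(1+y²)^(-(N+1)/2) E√q`,
and `E√q ≤ √N` replaces the Gamma-function constant of the Student density. The remaining integral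
is dominated by an explicit derivative. -/

/-! ### Linear functionals of Gaussian vectors -/

theorem hasLaw_inner_stdGaussian {E : Type*} [NormedAddCommGroup E] [InnerProductSpace ℝ E]
    [FiniteDimensional ℝ E] [MeasurableSpace E] [BorelSpace E] (u : E) :
    HasLaw (fun x : E => ⟪u, x⟫) (gaussianReal 0 (‖u‖₊ ^ 2)) (stdGaussian E) where
  map_eq := by
    have h : HasGaussianLaw (fun x : E => ⟪u, x⟫) (stdGaussian E) :=
      (IsGaussian.hasGaussianLaw_id (μ := stdGaussian E)).map_fun (innerSL ℝ u)
    have h1 : ∫ x, ⟪u, x⟫ ∂(stdGaussian E) = 0 := integral_strongDual_stdGaussian (innerSL ℝ u)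
    have h2 : Var[fun x : E => ⟪u, x⟫; stdGaussian E] = ‖u‖ ^ 2 := by
      have := variance_dual_stdGaussian (innerSL ℝ u)
      rwa [innerSL_apply_norm] at this
    rw [h.map_eq_gaussianReal, h1, h2]
    congr 1
    ext
    simp

/-- The covariance of the two functionals is `⟪u, v⟫`, and jointly Gaussian uncorrelated variables
are independent. -/
theorem hasLaw_inner_prodMk_inner_stdGaussian {E : Type*} [NormedAddCommGroup E]
    [InnerProductSpace ℝ E] [FiniteDimensional ℝ E] [MeasurableSpace E] [BorelSpace E] {u v : E}
    (huv : ⟪u, v⟫ = 0) :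
    HasLaw (fun x : E => (⟪u, x⟫, ⟪v, x⟫))
      ((gaussianReal 0 (‖u‖₊ ^ 2)).prod (gaussianReal 0 (‖v‖₊ ^ 2))) (stdGaussian E) := by
  refine IndepFun.hasLaw_prod (hasLaw_inner_stdGaussian u) (hasLaw_inner_stdGaussian v) ?_
  have h : HasGaussianLaw (fun x : E => (⟪u, x⟫, ⟪v, x⟫)) (stdGaussian E) :=
    (IsGaussian.hasGaussianLaw_id (μ := stdGaussian E)).map_fun
      ((innerSL ℝ u).prod (innerSL ℝ v))
  refine h.indepFun_of_covariance_eq_zero ?_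
  rw [← covarianceBilin_apply_eq_cov, covarianceBilin_stdGaussian]
  · exact huv
  · exact IsGaussian.memLp_two_id

theorem map_sum_mul_pi_gaussianReal {ι : Type*} [Fintype ι] (v : ℝ≥0) (c : ι → ℝ) :
    (Measure.pi fun _ : ι => gaussianReal 0 v).map (fun w => ∑ k, c k * w k) =
      gaussianReal 0 (v * ∑ k, ‖c k‖₊ ^ 2) := by
  classical
  have hv : gaussianReal 0 v = (gaussianReal 0 1).map (fun x => √v * x) := by
    rw [gaussianReal_map_const_mul]
    congr 1
    · simp
    · ext; simp
  have hpi : (Measure.pi fun _ : ι => gaussianReal 0 v) =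
      (Measure.pi fun _ : ι => gaussianReal 0 1).map (fun x k => √v * x k) := by
    simp_rw [hv]
    rw [Measure.pi_map_pi (fun _ => by fun_prop)]
  have h := hasLaw_inner_stdGaussian (WithLp.toLp 2 (fun k => √v * c k) : EuclideanSpace ℝ ι)
  have h' := h.map_eq
  rw [← map_pi_eq_stdGaussian, Measure.map_map (by fun_prop) (by fun_prop)] at h'
  rw [hpi, Measure.map_map (by fun_prop) (by fun_prop)]
  convert h' using 1
  · congr 1
    ext x
    simp [PiLp.inner_apply]
    exact Finset.sum_congr rfl fun k _ => by ring
  · congr 1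
    ext
    simp [EuclideanSpace.norm_sq_eq, mul_pow, Finset.mul_sum]

/-! ### The Student law as a Gaussian mixture -/

/-- Fubini form of conditioning on the first coordinate: equal conditional laws give equal laws. -/
theorem map_prod_congr_of_forall_map_eq {α β β' γ : Type*} [MeasurableSpace α] [MeasurableSpace β]
    [MeasurableSpace β'] [MeasurableSpace γ] {μ : Measure α} {ν : Measure β} {ν' : Measure β'}
    [SFinite ν] [SFinite ν'] {f : α × β → γ} {g : α × β' → γ} (hf : Measurable f)
    (hg : Measurable g)
    (h : ∀ a, ν.map (fun b => f (a, b)) = ν'.map (fun b => g (a, b))) :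
    (μ.prod ν).map f = (μ.prod ν').map g := by
  ext s hs
  rw [Measure.map_apply hf hs, Measure.map_apply hg hs, Measure.prod_apply (hf hs),
    Measure.prod_apply (hg hs)]
  refine lintegral_congr fun a => ?_
  have : ν.map (fun b => f (a, b)) s = ν'.map (fun b => g (a, b)) s := by rw [h a]
  rwa [Measure.map_apply (by fun_prop) hs, Measure.map_apply (by fun_prop) hs] at this

theorem studentT_eq_map_pi_prod (N : ℕ) :
    studentT N = ((Measure.pi fun _ : Fin N => gaussianReal 0 1).prod (gaussianReal 0 1)).map
      fun p => p.2 / √((∑ k, p.1 k ^ 2) / (N : ℝ)) := by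
  have : chiSquare N = (Measure.pi fun _ : Fin N => gaussianReal 0 1).map
    fun x => ∑ k, x k ^ 2 := rfl
  rw [studentT, this, ← Measure.prod_swap, Measure.map_map (by fun_prop) (by fun_prop)]
  nth_rewrite 2 [← Measure.map_id (μ := gaussianReal 0 1)]
  rw [Measure.map_prod_map _ _ (by fun_prop) (by fun_prop),
    Measure.map_map (by fun_prop) (by fun_prop)]
  rfl

/-- The ratio of the inner product of a scaled and a standard Gaussian vector to the squared norm
of the latter is a scaled Student variable. -/
theorem map_ratio_pi_prod_gaussianReal {N : ℕ} (hN : 1 ≤ N) (v : ℝ≥0) :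
    ((Measure.pi fun _ : Fin N => gaussianReal 0 1).prod
      (Measure.pi fun _ : Fin N => gaussianReal 0 v)).map
        (fun p => (∑ k, p.1 k * p.2 k) / ∑ k, p.1 k ^ 2) =
      (studentT N).map fun x => √((v : ℝ) / (N : ℝ)) * x := by
  have hN' : (0 : ℝ) < N := by exact_mod_cast hN
  rw [studentT_eq_map_pi_prod, Measure.map_map (by fun_prop) (by fun_prop)]
  -- For fixed `x` both sides are linear in a Gaussian, so only the variances, both `v / ∑ x_k²`,
  -- need comparing.
  refine map_prod_congr_of_forall_map_eq (by fun_prop) (by fun_prop) fun x => ?_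
  have h1 : (fun w : Fin N → ℝ => (∑ k, x k * w k) / ∑ k, x k ^ 2) =
      fun w => ∑ k, (x k / ∑ j, x j ^ 2) * w k := by
    ext w
    rw [Finset.sum_div]
    exact Finset.sum_congr rfl fun k _ => by ring
  have h2 : (fun b : ℝ => ((fun x => √((v : ℝ) / (N : ℝ)) * x) ∘
      fun p : (Fin N → ℝ) × ℝ => p.2 / √((∑ k, p.1 k ^ 2) / (N : ℝ))) (x, b)) =
      fun b => (√((v : ℝ) / (N : ℝ)) / √((∑ k, x k ^ 2) / (N : ℝ))) * b := by
    ext b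
    simp only [Function.comp]
    ring
  rw [h1, h2, map_sum_mul_pi_gaussianReal, gaussianReal_map_const_mul]
  congr 1
  · simp
  · ext
    have hq : 0 ≤ ∑ k, x k ^ 2 := Finset.sum_nonneg fun k _ => sq_nonneg _
    simp only [NNReal.coe_mul, NNReal.coe_sum, NNReal.coe_pow, coe_nnnorm, Real.norm_eq_abs, sq_abs,
      div_pow, NNReal.coe_mk, mul_one]
    rw [← Finset.sum_div, Real.sq_sqrt (by positivity), Real.sq_sqrt (by positivity)]
    -- At `x = 0`, division by zero makes both variances `0`.
    rcases hq.eq_or_lt with h | h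
    · simp [← h]
    · field_simp

/-! ### Exponential tilting of Gaussian vectors -/

theorem pi_withDensity_prod {ι : Type*} [Fintype ι] {α : ι → Type*} [∀ i, MeasurableSpace (α i)]
    (μ : ∀ i, Measure (α i)) [∀ i, IsProbabilityMeasure (μ i)] {f : ∀ i, α i → ℝ≥0∞}
    (hf : ∀ i, Measurable (f i)) [∀ i, SigmaFinite ((μ i).withDensity (f i))] :
    (Measure.pi μ).withDensity (fun x => ∏ i, f i (x i)) =
      Measure.pi fun i => (μ i).withDensity (f i) := by
  classical
  refine (Measure.pi_eq fun s hs => ?_).symm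
  rw [withDensity_apply _ (MeasurableSet.univ_pi hs),
    ← lintegral_indicator (MeasurableSet.univ_pi hs)]
  have hind : ∀ x : ∀ i, α i, (Set.univ.pi s).indicator (fun x => ∏ i, f i (x i)) x =
      ∏ i, (s i).indicator (f i) (x i) := by
    intro x
    by_cases hx : x ∈ Set.univ.pi s
    · rw [Set.indicator_of_mem hx]
      exact Finset.prod_congr rfl fun i _ =>
        (Set.indicator_of_mem (hx i (Set.mem_univ i)) _).symm
    · rw [Set.indicator_of_notMem hx]
      obtain ⟨i, hi⟩ : ∃ i, x i ∉ s i := by simpa [Set.mem_pi] using hx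
      exact (Finset.prod_eq_zero (Finset.mem_univ i) (Set.indicator_of_notMem hi _)).symm
  simp_rw [hind]
  have hm : ∀ i, Measurable ((s i).indicator (f i)) := fun i => (hf i).indicator (hs i)
  have hI : iIndepFun (fun i (x : ∀ i, α i) => (s i).indicator (f i) (x i)) (Measure.pi μ) :=
    iIndepFun_pi (X := fun i => (s i).indicator (f i)) fun i => (hm i).aemeasurable
  rw [lintegral_prod_eq_prod_lintegral_of_indepFun Finset.univ _ hI
    (fun i => (hm i).comp (measurable_pi_apply i))]
  refine Finset.prod_congr rfl fun i _ => ?_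
  rw [withDensity_apply _ (hs i), ← lintegral_indicator (hs i)]
  exact (measurePreserving_eval μ i).lintegral_comp (hm i)

/-- The exponents add to `-(1+y²)x²/2`: an unnormalised Gaussian of variance `1/(1+y²)` and total
mass `(1+y²)^(-1/2)`. -/
theorem gaussianReal_withDensity_exp (y : ℝ) :
    (gaussianReal 0 1).withDensity (fun x => ENNReal.ofReal (Real.exp (-(y ^ 2 * x ^ 2 / 2)))) =
      ENNReal.ofReal (√(1 + y ^ 2))⁻¹ •
        (gaussianReal 0 1).map (fun x => (√(1 + y ^ 2))⁻¹ * x) := by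
  have hy : 0 < 1 + y ^ 2 := by positivity
  have hv : NNReal.mk ((√(1 + y ^ 2))⁻¹ ^ 2) (sq_nonneg _) * 1 ≠ 0 := by
    rw [mul_one, Ne, ← NNReal.coe_eq_zero]
    simp only [NNReal.coe_mk]
    positivity
  rw [gaussianReal_map_const_mul, mul_zero, gaussianReal_of_var_ne_zero _ one_ne_zero,
    gaussianReal_of_var_ne_zero _ hv, ← withDensity_smul _ (by fun_prop),
    ← withDensity_mul _ (by fun_prop) (by fun_prop)]
  congr 1
  ext x
  simp only [Pi.mul_apply, Pi.smul_apply, smul_eq_mul, gaussianPDF, gaussianPDFReal,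
    NNReal.coe_mk, NNReal.coe_one, mul_one, sub_zero]
  rw [← ENNReal.ofReal_mul (by positivity), ← ENNReal.ofReal_mul (by positivity)]
  congr 1
  rw [inv_pow, Real.sq_sqrt hy.le, Real.sqrt_mul (by positivity) ((1 + y ^ 2)⁻¹),
    Real.sqrt_inv, mul_assoc, ← Real.exp_add]
  have : √(1 + y ^ 2) ≠ 0 := by positivity
  have h2 : -x ^ 2 / 2 + -(y ^ 2 * x ^ 2 / 2) = -x ^ 2 / (2 * (1 + y ^ 2)⁻¹) := by
    field_simp
    ring
  rw [h2]
  field_simp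

theorem pi_gaussianReal_withDensity_exp {N : ℕ} (y : ℝ) :
    (Measure.pi fun _ : Fin N => gaussianReal 0 1).withDensity
        (fun x => ENNReal.ofReal (Real.exp (-(y ^ 2 * (∑ k, x k ^ 2) / 2)))) =
      ENNReal.ofReal (√(1 + y ^ 2))⁻¹ ^ N •
        (Measure.pi fun _ : Fin N => gaussianReal 0 1).map
          (fun x k => (√(1 + y ^ 2))⁻¹ * x k) := by
  have h : (fun x : Fin N → ℝ => ENNReal.ofReal (Real.exp (-(y ^ 2 * (∑ k, x k ^ 2) / 2)))) =
      fun x => ∏ k, ENNReal.ofReal (Real.exp (-(y ^ 2 * (x k) ^ 2 / 2))) := by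
    ext x
    rw [← ENNReal.ofReal_prod_of_nonneg (fun _ _ => (Real.exp_pos _).le), ← Real.exp_sum,
      Finset.sum_neg_distrib, Finset.mul_sum, Finset.sum_div]
  have hfin : IsFiniteMeasure ((gaussianReal 0 1).withDensity
      (fun x => ENNReal.ofReal (Real.exp (-(y ^ 2 * x ^ 2 / 2))))) := by
    rw [gaussianReal_withDensity_exp]
    exact Measure.smul_finite _ ENNReal.ofReal_ne_top
  rw [h, pi_withDensity_prod (fun _ : Fin N => gaussianReal 0 1)
    (f := fun _ x => ENNReal.ofReal (Real.exp (-(y ^ 2 * x ^ 2 / 2)))) (fun _ => by fun_prop)]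
  refine Measure.pi_eq fun s hs => ?_
  simp_rw [gaussianReal_withDensity_exp]
  have hmap := Measure.pi_map_pi (μ := fun _ : Fin N => gaussianReal 0 1)
    (f := fun _ x => (√(1 + y ^ 2))⁻¹ * x) (fun _ => by fun_prop)
  rw [hmap]
  simp [Finset.prod_mul_distrib]

/-- AM-GM gives `√q ≤ (q/√N + √N)/2`, whose mean is `√N` because `E q = N`. -/
theorem lintegral_sqrt_sum_sq_pi_gaussianReal_le {N : ℕ} (hN : 1 ≤ N) :
    ∫⁻ x, ENNReal.ofReal √(∑ k, x k ^ 2) ∂(Measure.pi fun _ : Fin N => gaussianReal 0 1) ≤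
      ENNReal.ofReal √N := by
  have hN' : (0 : ℝ) < N := by exact_mod_cast hN
  have hint : Integrable (fun x : ℝ => x ^ 2) (gaussianReal 0 1) :=
    (memLp_id_gaussianReal 2).integrable_sq
  have hval : ∫ x, x ^ 2 ∂(gaussianReal 0 1) = 1 := by
    have := variance_fun_id_gaussianReal (μ := 0) (v := 1)
    rw [variance_eq_integral (by fun_prop)] at this
    simpa using this
  have hintk : ∀ k : Fin N, Integrable (fun x : Fin N → ℝ => x k ^ 2)
      (Measure.pi fun _ : Fin N => gaussianReal 0 1) := fun k =>
    (measurePreserving_eval (fun _ : Fin N => gaussianReal 0 1) k).integrable_comp_of_integrable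
      hint
  have hvalk : ∀ k : Fin N, ∫ x : Fin N → ℝ, x k ^ 2
      ∂(Measure.pi fun _ : Fin N => gaussianReal 0 1) = 1 := fun k => by
    rw [integral_comp_eval (μ := fun _ : Fin N => gaussianReal 0 1) (f := fun t : ℝ => t ^ 2)
      (by fun_prop), hval]
  have hs := integrable_finsetSum Finset.univ fun k _ => hintk k
  have hs' : Integrable (fun x : Fin N → ℝ => ((∑ k, x k ^ 2) / √N + √N) / 2)
      (Measure.pi fun _ : Fin N => gaussianReal 0 1) :=
    ((hs.div_const _).add (integrable_const _)).div_const _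
  calc _ ≤ ∫⁻ x, ENNReal.ofReal (((∑ k, x k ^ 2) / √N + √N) / 2)
        ∂(Measure.pi fun _ : Fin N => gaussianReal 0 1) := by
        refine lintegral_mono fun x => ENNReal.ofReal_le_ofReal ?_
        have hq : 0 ≤ ∑ k, x k ^ 2 := Finset.sum_nonneg fun k _ => sq_nonneg _
        have h0 : 0 < √(N : ℝ) := Real.sqrt_pos.2 hN'
        rw [le_div_iff₀ two_pos, ← sub_nonneg]
        have : (∑ k, x k ^ 2) / √N + √N - √(∑ k, x k ^ 2) * 2 =
            (√(∑ k, x k ^ 2) - √N) ^ 2 / √N := by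
          field_simp
          nlinarith [Real.sq_sqrt hq]
        rw [this]
        positivity
    _ = ENNReal.ofReal (∫ x, ((∑ k, x k ^ 2) / √N + √N) / 2
        ∂(Measure.pi fun _ : Fin N => gaussianReal 0 1)) := by
        refine (ofReal_integral_eq_lintegral_ofReal hs' (ae_of_all _ fun x => ?_)).symm
        positivity
    _ = _ := by
        congr 1
        rw [integral_div, integral_add (hs.div_const _) (integrable_const _), integral_div,
          integral_finsetSum _ fun k _ => hintk k]
        simp [hvalk]

/-- Tilting rescales the vector by `c = (1+y²)^(-1/2)` with mass `c^N`; the norm `√q` contributes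
one more factor `c`. -/
theorem lintegral_sqrt_sum_sq_mul_exp_le {N : ℕ} (hN : 1 ≤ N) (y : ℝ) :
    ∫⁻ x, ENNReal.ofReal (√(∑ k, x k ^ 2) * Real.exp (-(y ^ 2 * (∑ k, x k ^ 2) / 2)))
        ∂(Measure.pi fun _ : Fin N => gaussianReal 0 1) ≤
      ENNReal.ofReal (√N * (√(1 + y ^ 2))⁻¹ ^ (N + 1)) := by
  have h := lintegral_withDensity_eq_lintegral_mul
    (Measure.pi fun _ : Fin N => gaussianReal 0 1)
    (f := fun x => ENNReal.ofReal (Real.exp (-(y ^ 2 * (∑ k, x k ^ 2) / 2)))) (by fun_prop)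
    (g := fun x => ENNReal.ofReal √(∑ k, x k ^ 2)) (by fun_prop)
  rw [pi_gaussianReal_withDensity_exp, lintegral_smul_measure,
    lintegral_map (by fun_prop) (by fun_prop)] at h
  have hc : 0 ≤ (√(1 + y ^ 2))⁻¹ := by positivity
  calc _ = ENNReal.ofReal (√(1 + y ^ 2))⁻¹ ^ N *
        ∫⁻ x, ENNReal.ofReal √(∑ k, ((√(1 + y ^ 2))⁻¹ * x k) ^ 2)
          ∂(Measure.pi fun _ : Fin N => gaussianReal 0 1) := by
        rw [← smul_eq_mul, h]
        refine lintegral_congr fun x => ?_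
        rw [Pi.mul_apply, mul_comm, ENNReal.ofReal_mul (Real.exp_pos _).le]
    _ = ENNReal.ofReal (√(1 + y ^ 2))⁻¹ ^ (N + 1) *
        ∫⁻ x, ENNReal.ofReal √(∑ k, x k ^ 2)
          ∂(Measure.pi fun _ : Fin N => gaussianReal 0 1) := by
        rw [pow_succ (ENNReal.ofReal _), mul_assoc]
        congr 1
        rw [← lintegral_const_mul _ (by fun_prop)]
        refine lintegral_congr fun x => ?_
        simp_rw [mul_pow]
        rw [← Finset.mul_sum, Real.sqrt_mul (sq_nonneg _), Real.sqrt_sq hc,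
          ENNReal.ofReal_mul hc]
    _ ≤ ENNReal.ofReal (√(1 + y ^ 2))⁻¹ ^ (N + 1) * ENNReal.ofReal √N := by
        gcongr
        exact lintegral_sqrt_sum_sq_pi_gaussianReal_le hN
    _ = _ := by
        rw [mul_comm, ENNReal.ofReal_mul (Real.sqrt_nonneg _), ENNReal.ofReal_pow hc]

/-! ### Tail bound for the Student law -/

/-- The variable `g/√q` has variance `1/q`; its two symmetric tails double the density constant, and
`2/√(2π) = √(2/π)`. -/
theorem gaussianReal_abs_gt_eq {q : ℝ} (hq : 0 < q) {a : ℝ} (ha : 0 ≤ a) :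
    gaussianReal 0 1 {g | a < |g / √q|} =
      ∫⁻ y in Set.Ioi a,
        ENNReal.ofReal (√(2 / Real.pi) * (√q * Real.exp (-(y ^ 2 * q / 2)))) := by
  have hv : NNReal.mk q⁻¹ (inv_nonneg.2 hq.le) ≠ 0 := by
    rw [Ne, ← NNReal.coe_eq_zero]
    simp only [NNReal.coe_mk]
    positivity
  set ν := gaussianReal 0 (NNReal.mk q⁻¹ (inv_nonneg.2 hq.le)) with hν
  have h1 : gaussianReal 0 1 {g | a < |g / √q|} = ν {y | a < |y|} := by
    have hm : ν = (gaussianReal 0 1).map (fun g => g / √q) := by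
      rw [gaussianReal_map_div_const, hν]
      congr 1
      · simp
      · ext
        simp [Real.sq_sqrt hq.le]
    rw [hm, Measure.map_apply (by fun_prop) (measurableSet_lt (by fun_prop) (by fun_prop))]
    rfl
  have h2 : {y : ℝ | a < |y|} = Set.Ioi a ∪ Set.Iio (-a) := by
    ext y
    simp [lt_abs, lt_neg]
  have h3 : ν (Set.Iio (-a)) = ν (Set.Ioi a) := by
    have hm : ν.map (fun x => -x) = ν := by rw [hν, gaussianReal_map_neg, neg_zero]
    conv_lhs => rw [← hm]
    rw [Measure.map_apply (by fun_prop) measurableSet_Iio]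
    congr 1
    ext y
    simp
  have hdisj : Disjoint (Set.Ioi a) (Set.Iio (-a)) := by
    rw [Set.disjoint_left]
    intro y hy hy'
    simp only [Set.mem_Ioi, Set.mem_Iio] at hy hy'
    linarith
  rw [h1, h2, measure_union hdisj measurableSet_Iio, h3, ← two_mul, hν, gaussianReal_apply _ hv,
    ← lintegral_const_mul _ (by fun_prop)]
  refine lintegral_congr fun y => ?_
  rw [gaussianPDF_def, ← ENNReal.ofReal_ofNat, ← ENNReal.ofReal_mul (by positivity)]
  congr 1
  simp only [gaussianPDFReal, NNReal.coe_mk, sub_zero]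
  have e1 : -y ^ 2 / (2 * q⁻¹) = -(y ^ 2 * q / 2) := by field_simp
  have e2 : 2 * (√(2 * Real.pi * q⁻¹))⁻¹ = √(2 / Real.pi) * √q := by
    rw [← Real.sqrt_inv, ← Real.sqrt_mul (by positivity)]
    nth_rewrite 1 [show (2 : ℝ) = √4 by rw [show (4 : ℝ) = 2 ^ 2 by norm_num]; simp]
    rw [← Real.sqrt_mul (by positivity)]
    congr 1
    field_simp
    ring
  rw [e1, ← mul_assoc, ← mul_assoc, e2]

theorem lintegral_Ioi_le_of_hasDerivAt {f g g' : ℝ → ℝ} {a : ℝ}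
    (hderiv : ∀ x ∈ Set.Ici a, HasDerivAt g (g' x) x)
    (hf : ∀ x ∈ Set.Ioi a, 0 ≤ f x ∧ f x ≤ -g' x)
    (hlim : Filter.Tendsto g Filter.atTop (nhds 0)) :
    ∫⁻ x in Set.Ioi a, ENNReal.ofReal (f x) ≤ ENNReal.ofReal (g a) := by
  have hneg : ∀ x ∈ Set.Ioi a, g' x ≤ 0 := fun x hx => by linarith [(hf x hx).1, (hf x hx).2]
  have hint : IntegrableOn g' (Set.Ioi a) :=
    integrableOn_Ioi_deriv_of_nonpos' hderiv hneg hlim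
  have hval := integral_Ioi_of_hasDerivAt_of_nonpos' hderiv hneg hlim
  calc _ ≤ ∫⁻ x in Set.Ioi a, ENNReal.ofReal (-g' x) :=
        setLIntegral_mono' measurableSet_Ioi fun x hx => ENNReal.ofReal_le_ofReal (hf x hx).2
    _ = ENNReal.ofReal (∫ x in Set.Ioi a, -g' x) := by
        refine (ofReal_integral_eq_lintegral_ofReal hint.neg ?_).symm
        filter_upwards [ae_restrict_mem measurableSet_Ioi] with x hx
        simpa using hneg x hx
    _ = _ := by
        rw [integral_neg, hval]
        simp

/-- With `g(y) = (Ny)⁻¹(1+y²)^(-(N-1)/2)`, one has `-g'(y) = (1+y²)^(-(N+1)/2) (1 + 1/(Ny²))`, which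
dominates the integrand. -/
theorem lintegral_Ioi_sqrt_inv_pow_le {N : ℕ} (hN : 1 ≤ N) {a : ℝ} (ha : 0 < a) :
    ∫⁻ y in Set.Ioi a, ENNReal.ofReal ((√(1 + y ^ 2))⁻¹ ^ (N + 1)) ≤
      ENNReal.ofReal ((N * a)⁻¹ * (1 + a ^ 2) ^ (-(((N : ℝ) - 1) / 2))) := by
  have hN' : (1 : ℝ) ≤ N := by exact_mod_cast hN
  set e : ℝ := -(((N : ℝ) - 1) / 2) with he
  refine lintegral_Ioi_le_of_hasDerivAt (g := fun y => (N * y)⁻¹ * (1 + y ^ 2) ^ e)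
    (g' := fun y => -(N / (N * y) ^ 2) * (1 + y ^ 2) ^ e +
      (N * y)⁻¹ * (2 * y * e * (1 + y ^ 2) ^ (e - 1))) ?_ ?_ ?_
  · intro y hy
    have hy0 : 0 < y := lt_of_lt_of_le ha hy
    have h1 : HasDerivAt (fun y : ℝ => (N * y)⁻¹) (-(N / (N * y) ^ 2)) y := by
      have := ((hasDerivAt_id y).const_mul (N : ℝ)).fun_inv
        (by simp only [id]; positivity)
      simpa [neg_div] using this
    have h2 : HasDerivAt (fun y : ℝ => (1 + y ^ 2) ^ e) (2 * y * e * (1 + y ^ 2) ^ (e - 1)) y := by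
      have h3 : HasDerivAt (fun y : ℝ => 1 + y ^ 2) (2 * y) y := by
        simpa using (hasDerivAt_pow 2 y).const_add 1
      exact h3.rpow_const (Or.inl (by positivity))
    exact h1.mul h2
  · intro y hy
    have hy0 : 0 < y := lt_trans ha hy
    have hp : 0 < 1 + y ^ 2 := by positivity
    refine ⟨by positivity, ?_⟩
    have h1 : (√(1 + y ^ 2))⁻¹ ^ (N + 1) = (1 + y ^ 2) ^ (e - 1) := by
      rw [Real.sqrt_eq_rpow, ← Real.rpow_neg hp.le, ← Real.rpow_mul_natCast hp.le]
      congr 1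
      push_cast
      rw [he]
      ring
    have h2 : (1 + y ^ 2) ^ e = (1 + y ^ 2) ^ (e - 1) * (1 + y ^ 2) := by
      rw [← Real.rpow_add_one hp.ne', sub_add_cancel]
    rw [h1, h2]
    have h3 : -(-(N / (N * y) ^ 2) * ((1 + y ^ 2) ^ (e - 1) * (1 + y ^ 2)) +
        (N * y)⁻¹ * (2 * y * e * (1 + y ^ 2) ^ (e - 1))) =
        (1 + y ^ 2) ^ (e - 1) * (1 + (N * y ^ 2)⁻¹) := by
      rw [he]
      field_simp
      ring
    rw [h3]
    refine le_mul_of_one_le_right (by positivity) ?_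
    have : 0 < (N * y ^ 2)⁻¹ := by positivity
    linarith
  · have hlim : Filter.Tendsto (fun y : ℝ => (N * y)⁻¹) Filter.atTop (nhds 0) :=
      tendsto_inv_atTop_zero.comp
        (Filter.tendsto_id.const_mul_atTop (by positivity : (0 : ℝ) < N))
    refine tendsto_of_tendsto_of_tendsto_of_le_of_le' tendsto_const_nhds hlim ?_ ?_
    · filter_upwards [Filter.eventually_gt_atTop 0] with y hy
      positivity
    · filter_upwards [Filter.eventually_gt_atTop 0] with y hy
      refine mul_le_of_le_one_right (by positivity) ?_
      refine Real.rpow_le_one_of_one_le_of_nonpos (by nlinarith) ?_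
      rw [he]
      linarith

theorem studentT_tail_le {N : ℕ} (hN : 1 ≤ N) {a : ℝ} (ha : 0 < a) :
    studentT N {x | a < |(√N)⁻¹ * x|} ≤
      ENNReal.ofReal (√(2 / (Real.pi * N)) * (1 / a) *
        (1 + a ^ 2) ^ (-(((N : ℝ) - 1) / 2))) := by
  have hN' : (0 : ℝ) < N := by exact_mod_cast hN
  set P := Measure.pi fun _ : Fin N => gaussianReal 0 1 with hP
  rw [studentT_eq_map_pi_prod, Measure.map_apply (by fun_prop)
    (measurableSet_lt (by fun_prop) (by fun_prop)), Measure.prod_apply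
    ((measurableSet_lt (by fun_prop) (by fun_prop)).preimage (by fun_prop))]
  calc _ ≤ ∫⁻ x, (∫⁻ y in Set.Ioi a, ENNReal.ofReal (√(2 / Real.pi) * (√(∑ k, x k ^ 2) *
          Real.exp (-(y ^ 2 * (∑ k, x k ^ 2) / 2))))) ∂P := by
        refine lintegral_mono fun x => ?_
        have hq : 0 ≤ ∑ k, x k ^ 2 := Finset.sum_nonneg fun k _ => sq_nonneg _
        have hset : Prod.mk x ⁻¹' ((fun p : (Fin N → ℝ) × ℝ => p.2 / √((∑ k, p.1 k ^ 2) / (N : ℝ)))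
            ⁻¹' {x | a < |(√N)⁻¹ * x|}) = {g | a < |g / √(∑ k, x k ^ 2)|} := by
          ext g
          simp only [Set.mem_preimage, Set.mem_ofPred_eq]
          rw [Real.sqrt_div hq]
          have : √(N : ℝ) ≠ 0 := by positivity
          have e : (√(N : ℝ))⁻¹ * (g / (√(∑ k, x k ^ 2) / √N)) = g / √(∑ k, x k ^ 2) := by
            rw [div_div_eq_mul_div, ← mul_div_assoc, mul_comm g, inv_mul_cancel_left₀ this]
          rw [e]
        rw [hset]
        -- If `q = 0` the quotient is `0` by convention, so the event is empty because `a > 0`.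
        rcases hq.eq_or_lt with h | h
        · simp [← h, not_lt.2 ha.le]
        · exact (gaussianReal_abs_gt_eq h ha.le).le
    _ = ∫⁻ y in Set.Ioi a, ∫⁻ x, ENNReal.ofReal (√(2 / Real.pi) * (√(∑ k, x k ^ 2) *
          Real.exp (-(y ^ 2 * (∑ k, x k ^ 2) / 2)))) ∂P :=
        lintegral_lintegral_swap (by fun_prop)
    _ ≤ ∫⁻ y in Set.Ioi a, ENNReal.ofReal (√(2 / Real.pi) * √N) *
          ENNReal.ofReal ((√(1 + y ^ 2))⁻¹ ^ (N + 1)) := by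
        refine lintegral_mono fun y => ?_
        simp_rw [ENNReal.ofReal_mul (Real.sqrt_nonneg (2 / Real.pi))]
        rw [lintegral_const_mul _ (by fun_prop), mul_assoc, ← ENNReal.ofReal_mul (by positivity)]
        gcongr
        exact lintegral_sqrt_sum_sq_mul_exp_le hN y
    _ = ENNReal.ofReal (√(2 / Real.pi) * √N) *
          ∫⁻ y in Set.Ioi a, ENNReal.ofReal ((√(1 + y ^ 2))⁻¹ ^ (N + 1)) :=
        lintegral_const_mul _ (by fun_prop)
    _ ≤ ENNReal.ofReal (√(2 / Real.pi) * √N) *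
          ENNReal.ofReal ((N * a)⁻¹ * (1 + a ^ 2) ^ (-(((N : ℝ) - 1) / 2))) := by
        gcongr
        exact lintegral_Ioi_sqrt_inv_pow_le hN ha
    _ = _ := by
        rw [← ENNReal.ofReal_mul (by positivity), ← mul_assoc]
        congr 2
        have e : √(2 / (Real.pi * N)) = √(2 / Real.pi) / √N := by
          rw [← div_div, Real.sqrt_div (by positivity)]
        rw [e]
        have : √(N : ℝ) ≠ 0 := by positivity
        field_simp
        rw [Real.sq_sqrt hN'.le]

/-! ### The diagonal error of the estimator -/

/-- The coefficient vector `a_i - a_ii e_i` of the error of the `i`-th diagonal estimate. -/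
noncomputable def offDiagCol {n : ℕ} (A : Matrix (Fin n) (Fin n) ℝ) (i : Fin n) :
    EuclideanSpace ℝ (Fin n) :=
  WithLp.toLp 2 (A.col i) - EuclideanSpace.single i (A i i)

theorem inner_single_offDiagCol {n : ℕ} (A : Matrix (Fin n) (Fin n) ℝ) (i : Fin n) :
    ⟪(EuclideanSpace.single i 1 : EuclideanSpace ℝ (Fin n)), offDiagCol A i⟫ = 0 := by
  simp [EuclideanSpace.inner_single_left, offDiagCol]

theorem norm_sq_offDiagCol {n : ℕ} (A : Matrix (Fin n) (Fin n) ℝ) (i : Fin n) :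
    ‖offDiagCol A i‖ ^ 2 = colNormSq A i - A i i ^ 2 := by
  rw [offDiagCol, norm_sub_sq_real, colNormSq, EuclideanSpace.inner_single_right]
  simp
  ring

/-- Symmetry turns row `i` of `A` into column `i`; subtracting `A i i` times the denominator removes
the `e_i` component of that column. -/
theorem normalizedEstimator_diag_sub {n N : ℕ} {A : Matrix (Fin n) (Fin n) ℝ} (hA : A.IsSymm)
    (z : Fin N → EuclideanSpace ℝ (Fin n)) (i : Fin n) (hz : ∑ k, z k i ^ 2 ≠ 0) :
    normalizedEstimator A z i i - A i i =
      (∑ k, z k i * ⟪offDiagCol A i, z k⟫) / ∑ k, z k i ^ 2 := by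
  have h1 : (∑ k, Matrix.vecMulVec (z k) (z k)) i i = ∑ k, z k i ^ 2 := by
    simp [Matrix.sum_apply, Matrix.vecMulVec_apply, sq]
  have h2 : (∑ k, A * Matrix.vecMulVec (z k) (z k)) i i =
      ∑ k, z k i * ⟪(WithLp.toLp 2 (A.col i) : EuclideanSpace ℝ (Fin n)), z k⟫ := by
    simp only [Matrix.sum_apply, Matrix.mul_apply, Matrix.vecMulVec_apply, PiLp.inner_apply]
    refine Finset.sum_congr rfl fun k _ => ?_
    rw [Finset.mul_sum]
    refine Finset.sum_congr rfl fun j _ => ?_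
    simp [hA.apply]
    ring
  have h3 : ∀ k, ⟪offDiagCol A i, z k⟫ =
      ⟪(WithLp.toLp 2 (A.col i) : EuclideanSpace ℝ (Fin n)), z k⟫ - A i i * z k i := by
    intro k
    rw [offDiagCol, inner_sub_left, EuclideanSpace.inner_single_left]
    simp
  rw [normalizedEstimator, elementwiseDiv, Matrix.of_apply, h1, h2]
  rw [div_sub' hz]
  congr 1
  simp_rw [h3, mul_sub, Finset.sum_sub_distrib, Finset.sum_mul]
  congr 1
  exact Finset.sum_congr rfl fun k _ => by ring

theorem theorem5p9 {n N : ℕ} (hN : 1 ≤ N) (A : Matrix (Fin n) (Fin n) ℝ) (hA : A.IsSymm)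
    {Ω : Type*} [MeasurableSpace Ω] (μ : Measure Ω) [IsProbabilityMeasure μ]
    (z : Fin N → Ω → EuclideanSpace ℝ (Fin n))
    (hz : ∀ k, HasLaw (z k) (stdGaussian (EuclideanSpace ℝ (Fin n))) μ)
    (hind : iIndepFun z μ) (i : Fin n) :
    (∀ᵐ ω ∂μ, (∑ k, Matrix.vecMulVec (z k ω) (z k ω)) i i ≠ 0) ∧
    HasLaw (fun ω => normalizedEstimator A (fun k => z k ω) i i - A i i)
      ((studentT N).map fun x => √((colNormSq A i - A i i ^ 2) / (N : ℝ)) * x) μ ∧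
    ∀ t : ℝ, 0 < t →
      μ.real {ω | t < |normalizedEstimator A (fun k => z k ω) i i - A i i|} ≤
        √(2 * (colNormSq A i - A i i ^ 2) / (Real.pi * (N : ℝ))) * (1 / t) *
          (1 + t ^ 2 / (colNormSq A i - A i i ^ 2)) ^ (-(((N : ℝ) - 1) / 2)) := by
  have hN' : (0 : ℝ) < N := by exact_mod_cast hN
  have hpair : ∀ k, HasLaw (fun ω => (z k ω i, ⟪offDiagCol A i, z k ω⟫))
      ((gaussianReal 0 1).prod (gaussianReal 0 (‖offDiagCol A i‖₊ ^ 2))) μ := by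
    intro k
    have h := (hasLaw_inner_prodMk_inner_stdGaussian (inner_single_offDiagCol A i)).fun_comp (hz k)
    simpa [EuclideanSpace.inner_single_left] using h
  have hpairs := iIndepFun.hasLaw_pi hpair
    (hind.comp (fun _ x => (x i, ⟪offDiagCol A i, x⟫)) (fun _ => by fun_prop))
  -- Regroups the `N` independent pairs `(x_k, w_k)` into two independent vectors `x` and `w`.
  have hjoint := (measurePreserving_arrowProdEquivProdArrow ℝ ℝ (Fin N)
    (fun _ => gaussianReal 0 1)
    (fun _ => gaussianReal 0 (‖offDiagCol A i‖₊ ^ 2))).fun_comp_hasLaw hpairs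
  -- One almost surely nonzero summand suffices; it exists because `N ≥ 1`.
  have hne : ∀ᵐ ω ∂μ, ∑ k, z k ω i ^ 2 ≠ 0 := by
    have h0 : ∀ᵐ x ∂(gaussianReal 0 1), x ≠ 0 := by
      have := nullSingletonClass_gaussianReal (μ := 0) one_ne_zero
      exact Measure.ae_ne _ 0
    have hfst : HasLaw (fun ω => z ⟨0, hN⟩ ω i) (gaussianReal 0 1) μ :=
      measurePreserving_fst.fun_comp_hasLaw (hpair ⟨0, hN⟩)
    rw [← hfst.map_eq] at h0
    filter_upwards [ae_of_ae_map hfst.aemeasurable h0] with ω hω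
    refine (Finset.sum_pos' (fun k _ => sq_nonneg _) ⟨⟨0, hN⟩, Finset.mem_univ _, ?_⟩).ne'
    positivity
  have hlaw : HasLaw (fun ω => normalizedEstimator A (fun k => z k ω) i i - A i i)
      ((studentT N).map fun x => √((colNormSq A i - A i i ^ 2) / (N : ℝ)) * x) μ := by
    have h : HasLaw (fun p : (Fin N → ℝ) × (Fin N → ℝ) => (∑ k, p.1 k * p.2 k) / ∑ k, p.1 k ^ 2)
        ((studentT N).map fun x => √((colNormSq A i - A i i ^ 2) / (N : ℝ)) * x)
        ((Measure.pi fun _ : Fin N => gaussianReal 0 1).prod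
          (Measure.pi fun _ : Fin N => gaussianReal 0 (‖offDiagCol A i‖₊ ^ 2))) :=
      ⟨by fun_prop, by
        rw [map_ratio_pi_prod_gaussianReal hN, NNReal.coe_pow, coe_nnnorm, norm_sq_offDiagCol]⟩
    refine (h.fun_comp hjoint).congr ?_
    filter_upwards [hne] with ω hω
    exact normalizedEstimator_diag_sub hA _ i hω
  refine ⟨?_, hlaw, fun t ht => ?_⟩
  · filter_upwards [hne] with ω hω
    convert hω using 1
    simp [Matrix.sum_apply, Matrix.vecMulVec_apply, sq]
  · have hmeas : MeasurableSet {x : ℝ | t < |x|} := measurableSet_lt (by fun_prop) (by fun_prop)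
    rw [hlaw.measureReal_eq hmeas, measureReal_def, Measure.map_apply (by fun_prop) hmeas]
    rw [← norm_sq_offDiagCol]
    set s := ‖offDiagCol A i‖ with hs
    have hs0 : 0 ≤ s := norm_nonneg _
    -- If `s = 0` the error law is concentrated at `0`. Otherwise factoring out `s` reduces to the
    -- Student tail at `a = t/s`.
    rcases hs0.eq_or_lt with h | h
    · simp [← h, not_lt.2 ht.le]
    · have hset : (fun x => √(s ^ 2 / (N : ℝ)) * x) ⁻¹' {x | t < |x|} =
          {x | t / s < |(√N)⁻¹ * x|} := by
        ext x
        simp only [Set.mem_preimage, Set.mem_ofPred_eq]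
        rw [Real.sqrt_div (sq_nonneg _), Real.sqrt_sq hs0, div_lt_iff₀ h, div_eq_mul_inv,
          mul_assoc, abs_mul s, abs_of_pos h, mul_comm]
      rw [hset]
      refine ENNReal.toReal_le_of_le_ofReal (by positivity) ?_
      refine (studentT_tail_le hN (div_pos ht h)).trans_eq ?_
      rw [div_pow, mul_comm 2 (s ^ 2), mul_div_assoc, Real.sqrt_mul (sq_nonneg _),
        Real.sqrt_sq hs0]
      congr 2
      field_simp
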